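/- Let $1<p<\infty$ and $\sigma>0$. Let $X^p(\mathbb{R}_+)$ be the space of measurable $f:\mathbb{R}_+=(0,\infty)\to\mathbb{C}$, identified when equal almost everywhere, with $\|f\|_{X^p}:=\|x^{-1/p}f(x)\|_{L^p(\mathbb{R}_+)}<\infty$, and let $\Theta=x\frac{d}{dx}$ be the infinitesimal generator of the group $U(t)f(x)=f(e^tx)$ on $X^p(\mathbb{R}_+)$, i.e. $\Theta f=\lim_{t\to0}t^{-1}(U(t)f-f)$ in the norm of $X^p(\mathbb{R}_+)$. Let $\mathbf{B}^p_\sigma(\Theta)$ be the set of all $f\in X^p(\mathbb{R}_+)$ that lie in the domain of $\Theta^k$ and satisfy $\|\Theta^kf\|_{X^p}\le\sigma^k\|f\|_{X^p}$ for every $k\in\mathbb{N}$. Put $\operatorname{sinc}(x)=\frac{\sin\pi x}{\pi x}$ for $x\ne0$ and $\operatorname{sinc}(0)=1$. Let $f\in\mathbf{B}^p_\sigma(\Theta)$. Then $f$ has a (unique) continuous representative on $\mathbb{R}_+$, again denoted by $f$; it is differentiable at $1$, and for all $\tau\in\mathbb{R}_+$ $$f(\tau)=f(1)+\ln\tau\;(\partial_xf)(1)\,\operatorname{sinc}\left(\frac{\sigma}{\pi}\ln\tau\right)+\ln\tau\sum_{k\in\mathbb{Z}\setminus\{0\}}\frac{f\left(e^{k\pi/\sigma}\right)-f(1)}{k\pi/\sigma}\,\operatorname{sinc}\left(\frac{\sigma}{\pi}\ln\tau-k\right),$$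 where the series converges unconditionally, uniformly on compact subsets of $\mathbb{R}_+$. -/

import Mathlib

open Set Filter Topology MeasureTheory

namespace MellinBernstein

/-- The norm `‖f‖_{X^p(ℝ₊)} = ‖f(·) (·)^{-1/p}‖_{L^p(ℝ₊)}`. Functions on `ℝ₊ = (0, ∞)` are
represented by functions on `ℝ` whose values off `(0, ∞)` play no role. -/
noncomputable def xNorm (p : ℝ) (f : ℝ → ℂ) : ENNReal :=
  eLpNorm (fun x : ℝ => f x * ((x ^ (-1 / p) : ℝ) : ℂ)) (ENNReal.ofReal p)
    (volume.restrict (Ioi (0 : ℝ)))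

/-- `f ∈ X^p(ℝ₊)`, i.e. `f(·) (·)^{-1/p} ∈ L^p(ℝ₊)`. -/
def MemX (p : ℝ) (f : ℝ → ℂ) : Prop :=
  MemLp (fun x : ℝ => f x * ((x ^ (-1 / p) : ℝ) : ℂ)) (ENNReal.ofReal p)
    (volume.restrict (Ioi (0 : ℝ)))

/-- The group of Mellin translations, `U(t) f (x) = f(e^t x)`. -/
noncomputable def mellinTranslation (t : ℝ) (f : ℝ → ℂ) : ℝ → ℂ :=
  fun x => f (Real.exp t * x)

/-- `f` is in the domain of the infinitesimal generator `Θ = x d/dx` of the group `U` in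
`X^p(ℝ₊)`, and `Θ f = g`: the quotients `(U(t) f - f) / t` tend to `g` in the norm of `X^p(ℝ₊)`
as `t → 0`. Such a `g` is unique almost everywhere on `(0, ∞)`. -/
def HasTheta (p : ℝ) (f g : ℝ → ℂ) : Prop :=
  MemX p f ∧ MemX p g ∧
    Tendsto (fun t : ℝ => xNorm p (fun x => (mellinTranslation t f x - f x) / (t : ℂ) - g x))
      (𝓝[≠] 0) (𝓝 0)

/-- The Bernstein space `B_σ^p(Θ)`: all `f` in `X^p(ℝ₊)` which lie in the domain of every power
`Θ^k` (the function `F k` is `Θ^k f`) and satisfy `‖Θ^k f‖ ≤ σ^k ‖f‖` for all `k`. -/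
def MemBernstein (p σ : ℝ) (f : ℝ → ℂ) : Prop :=
  MemX p f ∧ ∃ F : ℕ → ℝ → ℂ, F 0 = f ∧ (∀ k, HasTheta p (F k) (F (k + 1))) ∧
    ∀ k, xNorm p (F k) ≤ ENNReal.ofReal (σ ^ k) * xNorm p f

/-- `g` is a continuous representative on `ℝ₊` of the element of `X^p(ℝ₊)` given by `f`. -/
def IsContinuousRep (f g : ℝ → ℂ) : Prop :=
  ContinuousOn g (Ioi (0 : ℝ)) ∧ f =ᵐ[volume.restrict (Ioi (0 : ℝ))] g

/-- The normalized cardinal sine, `sinc x = sin (π x) / (π x)` and `sinc 0 = 1`. -/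
noncomputable def nsinc (x : ℝ) : ℝ := Real.sinc (Real.pi * x)

/-- The `k`-th term, as a function of `τ`, of the sampling series of the difference quotient:
`(f(e^{kπ/σ}) - f(1)) / (kπ/σ) * sinc ((σ/π) ln τ - k)`. -/
noncomputable def samplingTerm (σ : ℝ) (f : ℝ → ℂ) (k : ℤ) (τ : ℝ) : ℂ :=
  (f (Real.exp ((k : ℝ) * Real.pi / σ)) - f 1) / (((k : ℝ) * Real.pi / σ : ℝ) : ℂ) *
    ((nsinc (σ / Real.pi * Real.log τ - (k : ℝ)) : ℝ) : ℂ)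

end MellinBernstein

namespace MellinBernstein

open scoped FourierTransform
open Real (pi_pos)

/-! In the variable `u = ln x` the space `X^p` becomes `L^p(ℝ)` and `Θ` becomes `d/du`. An element
of the Bernstein space thus becomes a smooth function whose `k`-th derivative has `L^p` norm at most
`σ^k` times a constant; comparing sup norms with `L^p` norms of a function and its derivative
(`enorm_le_eLpNorm_add_eLpNorm_deriv`) makes this a uniform bound `C σ^k`.

Rescale to `σ = π` and let `q(x) = (F(x) - F(0)) / x`. Its derivatives keep the growth rate `π^k`
and gain decay `1 / (1 + |x|)` (`IsJet.quot`); so do those of `sinc`, a multiple of the difference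
quotient of `sin (π x)`. Hence `q(x) sinc(x - u)` is integrable with growth rate `2π`, so its
Fourier transform vanishes for `|ξ| ≥ 1`, and by Poisson summation its sum over `u + ℤ` equals its
sum over `ℤ`. The former is `q(u)`, the latter the cardinal series of `q`. Multiplying by `u` and
isolating the term `q(0) = F'(0)` gives the formula. No complex analysis enters: exponential type
appears only as derivative growth. -/

/-- `F k` is the `k`-th derivative of `F 0`, and is bounded by `σ ^ k` times the weight `w`. -/
structure IsJet (w : ℝ → ℝ) (σ : ℝ) (F : ℕ → ℝ → ℂ) : Prop where
  hasDerivAt : ∀ k x, HasDerivAt (F k) (F (k + 1) x) x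
  norm_le : ∀ k x, ‖F k x‖ ≤ w x * σ ^ k

/-! ### Jets: products, Fourier support, Poisson summation. -/

namespace IsJet

variable {w w' : ℝ → ℝ} {σ σ' : ℝ} {F F' : ℕ → ℝ → ℂ}

theorem continuous (hF : IsJet w σ F) (k : ℕ) : Continuous (F k) :=
  continuous_iff_continuousAt.2 fun x => (hF.hasDerivAt k x).continuousAt

theorem mono (hF : IsJet w σ F) (hσ : 0 ≤ σ) (h : ∀ x, w x ≤ w' x) : IsJet w' σ F :=
  ⟨hF.hasDerivAt, fun k x => (hF.norm_le k x).trans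
    (mul_le_mul_of_nonneg_right (h x) (pow_nonneg hσ k))⟩

theorem hasDerivAt_comp (hF : IsJet w σ F) (k : ℕ) {u : ℝ → ℝ} {u' x : ℝ}
    (hu : HasDerivAt u u' x) :
    HasDerivAt (fun x => F k (u x)) ((u' : ℂ) * F (k + 1) (u x)) x :=
  (hF.hasDerivAt k (u x)).scomp x hu

theorem comp_mul_sub (hF : IsJet w σ F) (a b : ℝ) (ha : 0 ≤ a) :
    IsJet (fun x => w (a * x - b)) (a * σ) (fun k x => (a : ℂ) ^ k * F k (a * x - b)) where
  hasDerivAt k x := by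
    have h1 : HasDerivAt (fun x : ℝ => a * x - b) a x := by
      simpa using ((hasDerivAt_id x).const_mul a).sub_const b
    exact ((hF.hasDerivAt_comp k h1).const_mul ((a : ℂ) ^ k)).congr_deriv (by ring)
  norm_le k x := by
    rw [norm_mul, norm_pow, Complex.norm_real, Real.norm_of_nonneg ha, mul_pow]
    calc a ^ k * ‖F k (a * x - b)‖ ≤ a ^ k * (w (a * x - b) * σ ^ k) :=
          mul_le_mul_of_nonneg_left (hF.norm_le k _) (pow_nonneg ha k)
      _ = _ := by ring

/-- By the Leibniz rule and the binomial theorem, weights multiply and growth rates add. -/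
theorem mul (hF : IsJet w σ F) (hF' : IsJet w' σ' F') :
    IsJet (fun x => w x * w' x) (σ + σ') (fun k x => ∑ ij ∈ Finset.HasAntidiagonal.antidiagonal k,
      (k.choose ij.1 : ℂ) * (F ij.1 x * F' ij.2 x)) where
  hasDerivAt k x := by
    have h : HasDerivAt (fun x => ∑ ij ∈ Finset.HasAntidiagonal.antidiagonal k,
        (k.choose ij.1 : ℂ) * (F ij.1 x * F' ij.2 x)) (∑ ij ∈ Finset.HasAntidiagonal.antidiagonal k,
        (k.choose ij.1 : ℂ) * (F (ij.1 + 1) x * F' ij.2 x + F ij.1 x * F' (ij.2 + 1) x)) x :=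
      HasDerivAt.fun_sum fun ij _ =>
        ((hF.hasDerivAt ij.1 x).mul (hF'.hasDerivAt ij.2 x)).const_mul _
    refine h.congr_deriv ?_
    rw [Finset.sum_antidiagonal_choose_succ_mul (fun i j => F i x * F' j x) k,
      ← Finset.sum_add_distrib]
    refine Finset.sum_congr rfl fun ij hij => ?_
    rw [Nat.choose_symm_of_eq_add (Finset.HasAntidiagonal.mem_antidiagonal.1 hij).symm]
    ring
  norm_le k x := by
    calc ‖∑ ij ∈ Finset.HasAntidiagonal.antidiagonal k, (k.choose ij.1 : ℂ) * (F ij.1 x * F' ij.2 x)‖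
        ≤ ∑ ij ∈ Finset.HasAntidiagonal.antidiagonal k,
          (k.choose ij.1 : ℝ) * ((w x * σ ^ ij.1) * (w' x * σ' ^ ij.2)) := by
          refine norm_sum_le_of_le _ fun ij _ => ?_
          rw [norm_mul, norm_mul, Complex.norm_natCast]
          gcongr
          · exact (norm_nonneg _).trans (hF.norm_le _ _)
          · exact hF.norm_le _ _
          · exact hF'.norm_le _ _
      _ = w x * w' x * (σ + σ') ^ k := by
          rw [(Commute.all σ σ').add_pow', Finset.mul_sum]
          refine Finset.sum_congr rfl fun ij _ => ?_
          rw [nsmul_eq_mul]; ring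

theorem integrable (hF : IsJet w σ F) (hw : Integrable w) (k : ℕ) : Integrable (F k) :=
  (hw.mul_const (σ ^ k)).mono' (hF.continuous k).aestronglyMeasurable
    (Eventually.of_forall (hF.norm_le k))

theorem fourier_eq (hF : IsJet w σ F) (hw : Integrable w) (k : ℕ) (ξ : ℝ) :
    𝓕 (F k) ξ = (2 * Real.pi * Complex.I * ξ) ^ k * 𝓕 (F 0) ξ := by
  induction k with
  | zero => simp
  | succ k ih =>
    have hd : deriv (F k) = F (k + 1) := funext fun x => (hF.hasDerivAt k x).deriv
    have h := Real.fourier_deriv (hF.integrable hw k)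
      (fun x => (hF.hasDerivAt k x).differentiableAt) (hd ▸ hF.integrable hw (k + 1))
    rw [← hd, h]; simp only [smul_eq_mul, ih]; ring

theorem fourier_eq_zero_of_lt (hF : IsJet w σ F) (hw : Integrable w) (hσ : 0 < σ) {ξ : ℝ}
    (hξ : σ < 2 * Real.pi * |ξ|) : 𝓕 (F 0) ξ = 0 := by
  by_contra hne
  -- Differentiation multiplies the transform by `2πiξ`, while the `L^1` norm grows only by `σ` per
  -- derivative; a nonzero value would make the left side unbounded in `k`.
  have hbound : ∀ k : ℕ, ((2 * Real.pi * |ξ|) / σ) ^ k * ‖𝓕 (F 0) ξ‖ ≤ ∫ x, w x := by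
    intro k
    have h1 : ‖𝓕 (F k) ξ‖ ≤ ∫ x, ‖F k x‖ := by
      exact VectorFourier.norm_fourierIntegral_le_integral_norm _ _ _ _ _
    have h2 : ∫ x, ‖F k x‖ ≤ (∫ x, w x) * σ ^ k := by
      rw [← integral_mul_const]
      exact integral_mono (hF.integrable hw k).norm (hw.mul_const _) (hF.norm_le k)
    rw [hF.fourier_eq hw, norm_mul, norm_pow] at h1
    have h3 : ‖(2 * Real.pi * Complex.I * ξ : ℂ)‖ = 2 * Real.pi * |ξ| := by
      simp [abs_of_pos pi_pos]
    rw [h3] at h1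
    rw [div_pow, div_mul_eq_mul_div, div_le_iff₀ (pow_pos hσ k)]
    exact h1.trans h2
  have ht : Tendsto (fun k : ℕ => ((2 * Real.pi * |ξ|) / σ) ^ k * ‖𝓕 (F 0) ξ‖) atTop atTop :=
    (tendsto_pow_atTop_atTop_of_one_lt ((one_lt_div hσ).2 hξ)).atTop_mul_const
      (norm_pos_iff.2 hne)
  obtain ⟨k, hk⟩ := (ht.eventually_gt_atTop (∫ x, w x)).exists
  exact absurd (hbound k) (not_le.2 hk)

/-- Continuity extends the vanishing to the endpoint. This is essential for Poisson summation at
rate `2π`, where the frequencies `±1` lie exactly on the boundary. -/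
theorem fourier_eq_zero (hF : IsJet w σ F) (hw : Integrable w) (hσ : 0 < σ) {ξ : ℝ}
    (hξ : σ ≤ 2 * Real.pi * |ξ|) : 𝓕 (F 0) ξ = 0 := by
  have hc : Continuous (𝓕 (F 0)) :=
    VectorFourier.fourierIntegral_continuous Real.continuous_fourierChar
      (by exact continuous_inner) (hF.integrable hw 0)
  have hξ0 : 0 < |ξ| := by
    by_contra h
    have : |ξ| = 0 := le_antisymm (not_lt.1 h) (abs_nonneg _)
    rw [this] at hξ; linarith
  have ht : Tendsto (fun r : ℝ => 𝓕 (F 0) (r * ξ)) (𝓝[>] 1) (𝓝 (𝓕 (F 0) (1 * ξ))) :=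
    ((hc.comp (continuous_id.mul continuous_const)).tendsto 1).mono_left nhdsWithin_le_nhds
  have h0 : Tendsto (fun r : ℝ => 𝓕 (F 0) (r * ξ)) (𝓝[>] 1) (𝓝 0) := by
    refine tendsto_const_nhds.congr' ?_
    filter_upwards [self_mem_nhdsWithin] with r hr
    have hr : 1 < r := hr
    refine (hF.fourier_eq_zero_of_lt hw hσ ?_).symm
    rw [abs_mul, abs_of_pos (zero_lt_one.trans hr)]
    have := mul_lt_mul_of_pos_right hr (mul_pos Real.two_pi_pos hξ0)
    linarith
  simpa using tendsto_nhds_unique ht h0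

/-- Poisson summation at critical bandwidth: the sum over a translate of `ℤ` does not depend on
the translate. -/
theorem tsum_add_int (hF : IsJet w (2 * Real.pi) F) {A : ℝ} (hw : ∀ x, w x ≤ A * (1 + x ^ 2)⁻¹)
    (x : ℝ) : ∑' n : ℤ, F 0 (x + n) = ∑' n : ℤ, F 0 n := by
  have hF' := hF.mono Real.two_pi_pos.le hw
  have hi : Integrable fun x : ℝ => A * (1 + x ^ 2)⁻¹ := integrable_inv_one_add_sq.const_mul A
  have h0 : ∀ n : ℤ, n ≠ 0 → 𝓕 (F 0) n = 0 := fun n hn => by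
    refine hF'.fourier_eq_zero hi Real.two_pi_pos ?_
    have : (1 : ℝ) ≤ |(n : ℝ)| := by exact_mod_cast Int.one_le_abs hn
    nlinarith [Real.two_pi_pos]
  have hO : F 0 =O[cocompact ℝ] fun x : ℝ => |x| ^ (-2 : ℝ) := by
    refine Asymptotics.IsBigO.of_bound |A| ?_
    have : {0}ᶜ ∈ cocompact ℝ := isCompact_singleton.compl_mem_cocompact
    filter_upwards [this] with x hx
    have hx : 0 < x ^ 2 := by have : x ≠ 0 := hx; positivity
    have h1 : |x| ^ (-2 : ℝ) = (x ^ 2)⁻¹ := by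
      rw [Real.rpow_neg (abs_nonneg _), Real.rpow_two, sq_abs]
    rw [h1, Real.norm_of_nonneg (inv_nonneg.2 hx.le)]
    refine (hF'.norm_le 0 x).trans ?_
    rw [pow_zero, mul_one]
    refine mul_le_mul (le_abs_self A) ?_ (by positivity) (abs_nonneg A)
    exact inv_anti₀ hx (by linarith)
  have hs : Summable fun n : ℤ => 𝓕 (F 0) n :=
    summable_of_ne_finset_zero (s := {0}) fun n hn => h0 n (by simpa using hn)
  have key : ∀ y : ℝ, ∑' n : ℤ, F 0 (y + n) = 𝓕 (F 0) 0 := fun y => by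
    rw [Real.tsum_eq_tsum_fourier_of_rpow_decay_of_summable (hF.continuous 0) one_lt_two hO hs y,
      tsum_eq_single 0 fun n hn => by rw [h0 n hn, zero_mul]]
    simp
  rw [key x, ← key 0]
  simp

end IsJet

/-! ### Difference quotients. -/

/-- The derivatives of the difference quotient `(F 0 x - F 0 0) / x`. -/
noncomputable def quotJet (F : ℕ → ℝ → ℂ) (k : ℕ) (x : ℝ) : ℂ :=
  ∫ s in (0 : ℝ)..1, (s : ℂ) ^ k * F (k + 1) (s * x)

namespace IsJet

variable {w : ℝ → ℝ} {C σ : ℝ} {F : ℕ → ℝ → ℂ}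

theorem hasDerivAt_quotJet (hF : IsJet (fun _ => C) σ F) (k : ℕ) (x : ℝ) :
    HasDerivAt (quotJet F k) (quotJet F (k + 1) x) x := by
  have hcont : ∀ k x, Continuous fun s : ℝ => (s : ℂ) ^ k * F (k + 1) (s * x) := fun k x =>
    (Complex.continuous_ofReal.pow k).mul ((hF.continuous _).comp (by fun_prop))
  refine (intervalIntegral.hasDerivAt_integral_of_dominated_loc_of_deriv_le
    (F := fun x s => (s : ℂ) ^ k * F (k + 1) (s * x))
    (F' := fun x s => (s : ℂ) ^ (k + 1) * F (k + 1 + 1) (s * x))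
    (bound := fun _ => C * σ ^ (k + 2)) univ_mem
    (Eventually.of_forall fun y => (hcont k y).aestronglyMeasurable)
    ((hcont k x).intervalIntegrable 0 1) (hcont (k + 1) x).aestronglyMeasurable ?_
    intervalIntegrable_const ?_).2
  · refine Eventually.of_forall fun s hs y _ => ?_
    rw [uIoc_of_le zero_le_one] at hs
    rw [norm_mul, norm_pow, Complex.norm_real, Real.norm_of_nonneg hs.1.le]
    calc s ^ (k + 1) * ‖F (k + 1 + 1) (s * y)‖ ≤ 1 * ‖F (k + 1 + 1) (s * y)‖ := by
          gcongr
          exact pow_le_one₀ hs.1.le hs.2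
      _ ≤ _ := by rw [one_mul]; exact hF.norm_le _ _
  · refine Eventually.of_forall fun s _ y _ => ?_
    have h1 : HasDerivAt (fun x : ℝ => s * x) s y := by
      simpa using (hasDerivAt_id y).const_mul s
    exact ((hF.hasDerivAt_comp (k + 1) h1).const_mul ((s : ℂ) ^ k)).congr_deriv (by ring)

theorem mul_quotJet_zero (hF : IsJet (fun _ => C) σ F) (x : ℝ) :
    x * quotJet F 0 x = F 0 x - F 0 0 := by
  have h := intervalIntegral.integral_eq_sub_of_hasDerivAt (a := 0) (b := 1)
    (f := fun s : ℝ => F 0 (s * x)) (f' := fun s : ℝ => (x : ℂ) * F 1 (s * x)) (fun s _ => by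
      have h1 : HasDerivAt (fun s : ℝ => s * x) x s := by
        simpa using (hasDerivAt_id s).mul_const x
      exact hF.hasDerivAt_comp 0 h1) ((continuous_const.mul
        ((hF.continuous 1).comp (by fun_prop))).intervalIntegrable 0 1)
  rw [intervalIntegral.integral_const_mul] at h
  simpa [quotJet] using h

/-- This is the Leibniz rule for `x * q(x)`, obtained by integrating the `s`-derivative of `s^(k+1)
F^(k+1)(s x)` over `[0, 1]`. -/
theorem mul_quotJet_succ (hF : IsJet (fun _ => C) σ F) (k : ℕ) (x : ℝ) :
    x * quotJet F (k + 1) x + (k + 1) * quotJet F k x = F (k + 1) x := by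
  have hcont : ∀ k : ℕ, ∀ j, Continuous fun s : ℝ => (s : ℂ) ^ k * F j (s * x) := fun k j =>
    (Complex.continuous_ofReal.pow k).mul ((hF.continuous _).comp (by fun_prop))
  have h := intervalIntegral.integral_eq_sub_of_hasDerivAt (a := 0) (b := 1)
    (f := fun s : ℝ => (s : ℂ) ^ (k + 1) * F (k + 1) (s * x))
    (f' := fun s : ℝ => (x : ℂ) * ((s : ℂ) ^ (k + 1) * F (k + 1 + 1) (s * x)) +
      (k + 1) * ((s : ℂ) ^ k * F (k + 1) (s * x))) (fun s _ => by
      have h1 : HasDerivAt (fun s : ℝ => s * x) x s := by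
        simpa using (hasDerivAt_id s).mul_const x
      have h3 : HasDerivAt (fun s : ℝ => (s : ℂ) ^ (k + 1)) ((k + 1) * (s : ℂ) ^ k) s := by
        simpa using (HasDerivAt.fun_pow (HasDerivAt.ofReal_comp (hasDerivAt_id s)) (k + 1))
      exact (h3.mul (hF.hasDerivAt_comp (k + 1) h1)).congr_deriv (by ring))
    (((continuous_const.mul (hcont _ _)).add
      (continuous_const.mul (hcont _ _))).intervalIntegrable 0 1)
  have hint : ∀ (c : ℂ) k j, IntervalIntegrable (fun s : ℝ => c * ((s : ℂ) ^ k * F j (s * x)))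
      volume 0 1 := fun c k j => (continuous_const.mul (hcont k j)).intervalIntegrable 0 1
  rw [intervalIntegral.integral_add (hint _ _ _) (hint _ _ _),
    intervalIntegral.integral_const_mul, intervalIntegral.integral_const_mul] at h
  simpa [quotJet] using h

theorem quotJet_zero_zero (F : ℕ → ℝ → ℂ) : quotJet F 0 0 = F 1 0 := by simp [quotJet]

/-- The gain `1 / (k + 1)` is the integral of `s^k`; it cancels the factor `k + 1` in
`mul_quotJet_succ`. -/
theorem norm_quotJet_le (hF : IsJet (fun _ => C) σ F) (k : ℕ) (x : ℝ) :
    ‖quotJet F k x‖ ≤ C * σ ^ (k + 1) / (k + 1) := by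
  have h : ‖quotJet F k x‖ ≤ ∫ s in (0 : ℝ)..1, s ^ k * (C * σ ^ (k + 1)) := by
    refine intervalIntegral.norm_integral_le_of_norm_le zero_le_one
      (Eventually.of_forall fun s hs => ?_) ((by fun_prop : Continuous fun s : ℝ =>
        s ^ k * (C * σ ^ (k + 1))).intervalIntegrable 0 1)
    rw [norm_mul, norm_pow, Complex.norm_real, Real.norm_of_nonneg hs.1.le]
    exact mul_le_mul_of_nonneg_left (hF.norm_le _ _) (pow_nonneg hs.1.le k)
  refine h.trans (le_of_eq ?_)
  rw [intervalIntegral.integral_mul_const, integral_pow]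
  simp; ring

theorem quot (hF : IsJet (fun _ => C) σ F) (hσ : 0 ≤ σ) :
    IsJet (fun x => C * (2 + σ) * (1 + |x|)⁻¹) σ (quotJet F) where
  hasDerivAt := hF.hasDerivAt_quotJet
  norm_le k x := by
    have hC : 0 ≤ C := by simpa using (norm_nonneg _).trans (hF.norm_le 0 0)
    have hk : (0 : ℝ) < k + 1 := by positivity
    have h1 : ‖quotJet F k x‖ ≤ C * σ * σ ^ k := by
      refine (hF.norm_quotJet_le k x).trans ?_
      rw [div_le_iff₀ hk, pow_succ]
      have : 0 ≤ C * σ * σ ^ k * k := by positivity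
      nlinarith
    -- The two terms of the recursion contribute at most `C σ^k` each; together with `h1` this
    -- yields the constant `C (2 + σ)`.
    have h2 : |x| * ‖quotJet F k x‖ ≤ 2 * C * σ ^ k := by
      rw [← Real.norm_eq_abs, ← Complex.norm_real, ← norm_mul]
      cases k with
      | zero =>
        rw [hF.mul_quotJet_zero]
        refine (norm_sub_le _ _).trans ?_
        have ha := hF.norm_le 0 x
        have hb := hF.norm_le 0 0
        simp only [pow_zero] at ha hb ⊢
        linarith
      | succ k =>
        rw [eq_sub_of_add_eq (hF.mul_quotJet_succ k x)]
        refine (norm_sub_le _ _).trans ?_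
        have ha := hF.norm_le (k + 1) x
        have hb := hF.norm_quotJet_le k x
        have hk : (0 : ℝ) < k + 1 := by positivity
        rw [le_div_iff₀ hk] at hb
        have hc : ‖((k : ℂ) + 1) * quotJet F k x‖ = ‖quotJet F k x‖ * (k + 1) := by
          rw [norm_mul, mul_comm]
          congr 1
          exact_mod_cast Complex.norm_natCast (k + 1)
        linarith
    have hx : 0 < 1 + |x| := by positivity
    rw [mul_right_comm, ← div_eq_mul_inv, le_div_iff₀ hx]
    nlinarith

end IsJet

/-! ### The sine and the cardinal sine. -/

/-- The derivatives of `sin (π x)`. -/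
noncomputable def sinJet (k : ℕ) (x : ℝ) : ℂ :=
  ((Real.pi ^ k * Real.sin (Real.pi * x + k * (Real.pi / 2)) : ℝ) : ℂ)

theorem isJet_sinJet : IsJet (fun _ => 1) Real.pi sinJet where
  hasDerivAt k x := by
    have h1 : HasDerivAt (fun x : ℝ => Real.pi * x + k * (Real.pi / 2)) Real.pi x := by
      simpa using ((hasDerivAt_id x).const_mul Real.pi).add_const (k * (Real.pi / 2))
    refine (((h1.sin).const_mul (Real.pi ^ k)).ofReal_comp).congr_deriv ?_
    have h2 : Real.pi * x + ((k + 1 : ℕ) : ℝ) * (Real.pi / 2) =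
        Real.pi * x + k * (Real.pi / 2) + Real.pi / 2 := by push_cast; ring
    rw [sinJet, h2, Real.sin_add_pi_div_two, pow_succ]
    congr 1
    ring
  norm_le k x := by
    rw [sinJet, Complex.norm_real, norm_mul, norm_pow, Real.norm_of_nonneg Real.pi_pos.le,
      one_mul]
    exact mul_le_of_le_one_right (pow_nonneg Real.pi_pos.le k) (Real.abs_sin_le_one _)

theorem quotJet_sinJet (x : ℝ) : quotJet sinJet 0 x = Real.pi * (nsinc x : ℂ) := by
  rcases eq_or_ne x 0 with rfl | hx
  · simp [IsJet.quotJet_zero_zero, sinJet, nsinc]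
  · have h := isJet_sinJet.mul_quotJet_zero x
    have hx' : (x : ℂ) ≠ 0 := by exact_mod_cast hx
    have hpi : (Real.pi : ℂ) ≠ 0 := by exact_mod_cast Real.pi_ne_zero
    refine mul_left_cancel₀ hx' (h.trans ?_)
    rw [nsinc, Real.sinc_of_ne_zero (mul_ne_zero Real.pi_ne_zero hx)]
    simp only [sinJet]
    push_cast
    rw [mul_zero, zero_mul, add_zero, add_zero, Complex.sin_zero]
    field_simp
    simp

theorem nsinc_neg (x : ℝ) : nsinc (-x) = nsinc x := by simp [nsinc]

theorem nsinc_intCast {n : ℤ} (hn : n ≠ 0) : nsinc n = 0 := by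
  have : (n : ℝ) ≠ 0 := by exact_mod_cast hn
  rw [nsinc, Real.sinc_of_ne_zero (mul_ne_zero Real.pi_ne_zero this), mul_comm,
    Real.sin_int_mul_pi, zero_div]

theorem inv_one_add_abs_sub_le (x y : ℝ) : (1 + |x - y|)⁻¹ ≤ (1 + |x|) * (1 + |y|)⁻¹ := by
  rw [← div_eq_mul_inv, le_div_iff₀ (by positivity), inv_mul_le_iff₀ (by positivity)]
  have : |y| ≤ |x| + |x - y| := by
    have := abs_sub_abs_le_abs_sub y x
    rw [abs_sub_comm y x] at this
    linarith
  nlinarith [abs_nonneg x, abs_nonneg (x - y)]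

theorem abs_nsinc_sub_le (x y : ℝ) :
    |nsinc (x - y)| ≤ (2 + Real.pi) * ((1 + |x|) * (1 + |y|)⁻¹) := by
  have h := (isJet_sinJet.quot Real.pi_pos.le).norm_le 0 (x - y)
  rw [quotJet_sinJet, norm_mul, Complex.norm_real, Complex.norm_real,
    Real.norm_of_nonneg Real.pi_pos.le, Real.norm_eq_abs, pow_zero, mul_one, one_mul] at h
  have h1 : |nsinc (x - y)| ≤ Real.pi * |nsinc (x - y)| :=
    le_mul_of_one_le_left (abs_nonneg _) (by linarith [Real.pi_gt_three])
  exact h1.trans (h.trans (mul_le_mul_of_nonneg_left (inv_one_add_abs_sub_le x y)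
    (by linarith [Real.pi_pos])))

/-! ### The sampling formula at type `π`. -/

namespace IsJet

variable {C : ℝ} {F : ℕ → ℝ → ℂ}

/-- The cardinal series of the difference quotient of a bounded function of exponential type `π`. -/
theorem tsum_quotJet_mul_nsinc (hF : IsJet (fun _ => C) Real.pi F) (u : ℝ) :
    ∑' n : ℤ, quotJet F 0 n * (nsinc (u - n) : ℂ) = quotJet F 0 u := by
  have hC : 0 ≤ C := by simpa using (norm_nonneg _).trans (hF.norm_le 0 0)
  have hpi := Real.pi_pos
  have hJ := (hF.quot hpi.le).mul
    ((isJet_sinJet.quot hpi.le).comp_mul_sub 1 u zero_le_one)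
  have h2 : Real.pi + 1 * Real.pi = 2 * Real.pi := by ring
  rw [h2] at hJ
  have key := hJ.tsum_add_int (A := C * (2 + Real.pi) * ((2 + Real.pi) * (1 + |u|))) (fun x => by
    have hb := inv_one_add_abs_sub_le u x
    rw [abs_sub_comm] at hb
    have hx : (1 + |x|)⁻¹ * (1 + |x|)⁻¹ ≤ (1 + x ^ 2)⁻¹ := by
      rw [← mul_inv]
      refine inv_anti₀ (by positivity) ?_
      nlinarith [abs_nonneg x, sq_abs x]
    rw [one_mul, one_mul]
    calc C * (2 + Real.pi) * (1 + |x|)⁻¹ * ((2 + Real.pi) * (1 + |x - u|)⁻¹)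
        ≤ C * (2 + Real.pi) * (1 + |x|)⁻¹ * ((2 + Real.pi) * ((1 + |u|) * (1 + |x|)⁻¹)) := by
          gcongr
      _ = C * (2 + Real.pi) * ((2 + Real.pi) * (1 + |u|)) * ((1 + |x|)⁻¹ * (1 + |x|)⁻¹) := by ring
      _ ≤ _ := by gcongr) u
  simp only [Finset.HasAntidiagonal.antidiagonal_zero, Finset.sum_singleton, Nat.choose_zero_right, Nat.cast_one,
    one_mul, pow_zero, quotJet_sinJet, add_sub_cancel_left] at key
  -- On `u + ℤ` the `sinc` factor takes its values at integers, so only `n = 0` survives.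
  rw [tsum_eq_single 0 fun n hn => by rw [nsinc_intCast hn]; simp] at key
  have hne : (Real.pi : ℂ) ≠ 0 := by exact_mod_cast Real.pi_ne_zero
  have h0 : nsinc ((0 : ℤ) : ℝ) = 1 := by simp [nsinc]
  rw [h0, Int.cast_zero, add_zero, Complex.ofReal_one, mul_one] at key
  refine mul_right_cancel₀ hne ?_
  rw [key, ← tsum_mul_right]
  refine tsum_congr fun n => ?_
  rw [← nsinc_neg, neg_sub]
  ring

theorem norm_sampling_le (hF : IsJet (fun _ => C) Real.pi F) {R x : ℝ} (hx : |x| ≤ R) (n : ℤ) :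
    ‖(F 0 n - F 0 0) / n * (nsinc (x - n) : ℂ)‖ ≤
      2 * C * ((2 + Real.pi) * (1 + R)) * (1 / (n : ℝ) ^ 2) := by
  have hC : 0 ≤ C := by simpa using (norm_nonneg _).trans (hF.norm_le 0 0)
  have h1 : ‖F 0 n - F 0 0‖ ≤ 2 * C := by
    refine (norm_sub_le _ _).trans ?_
    have ha := hF.norm_le 0 n
    have hb := hF.norm_le 0 0
    simp only [pow_zero] at ha hb
    linarith
  rcases eq_or_ne n 0 with rfl | hn
  · simp
  have hn' : 0 < |(n : ℝ)| := abs_pos.2 (by exact_mod_cast hn)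
  have hR : 0 ≤ R := (abs_nonneg x).trans hx
  have hpi := Real.pi_pos
  rw [norm_mul, norm_div, Complex.norm_real, Complex.norm_intCast, Real.norm_eq_abs]
  calc ‖F 0 n - F 0 0‖ / |(n : ℝ)| * |nsinc (x - n)|
      ≤ 2 * C / |(n : ℝ)| * ((2 + Real.pi) * ((1 + R) * (|(n : ℝ)|)⁻¹)) := by
        gcongr
        refine (abs_nsinc_sub_le x n).trans ?_
        gcongr
        linarith
    _ = _ := by
        rw [← sq_abs (n : ℝ)]
        field_simp

theorem summable_sampling (hF : IsJet (fun _ => C) Real.pi F) (x : ℝ) :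
    Summable fun n : ℤ => (F 0 n - F 0 0) / n * (nsinc (x - n) : ℂ) :=
  .of_norm_bounded ((Real.summable_one_div_int_pow.2 one_lt_two).mul_left _)
    (hF.norm_sampling_le le_rfl)

/-- The sampling formula for bounded functions of exponential type `π`. -/
theorem sampling (hF : IsJet (fun _ => C) Real.pi F) (x : ℝ) :
    F 0 x = F 0 0 + x * F 1 0 * (nsinc x : ℂ) +
      x * ∑' k : {k : ℤ // k ≠ 0}, (F 0 (k : ℤ) - F 0 0) / (k : ℤ) * (nsinc (x - (k : ℤ)) : ℂ) := by
  have hq : ∀ n : ℤ, n ≠ 0 → quotJet F 0 n = (F 0 n - F 0 0) / n := fun n hn => by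
    have hn' : (n : ℂ) ≠ 0 := by exact_mod_cast hn
    rw [eq_div_iff hn', ← hF.mul_quotJet_zero n, mul_comm, Complex.ofReal_intCast]
  have hs := hF.summable_sampling x
  -- At `n = 0` the quotient `(F 0 0 - F 0 0) / 0` is `0` by convention, so the derivative term must
  -- be added separately.
  have hterm : (fun n : ℤ => quotJet F 0 n * (nsinc (x - n) : ℂ)) =
      fun n : ℤ => (if n = 0 then F 1 0 * (nsinc x : ℂ) else 0) +
        (F 0 n - F 0 0) / n * (nsinc (x - n) : ℂ) := by
    funext n
    rcases eq_or_ne n 0 with rfl | hn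
    · simp [quotJet_zero_zero]
    · rw [hq n hn, if_neg hn, zero_add]
  have h := hF.tsum_quotJet_mul_nsinc x
  rw [hterm, Summable.tsum_add (summable_of_ne_finset_zero (s := {0}) fun n hn =>
    if_neg (by simpa using hn)) hs, tsum_ite_eq] at h
  have hsub : ∑' k : {k : ℤ // k ≠ 0}, (F 0 (k : ℤ) - F 0 0) / (k : ℤ) *
      (nsinc (x - (k : ℤ)) : ℂ) = ∑' n : ℤ, (F 0 n - F 0 0) / n * (nsinc (x - n) : ℂ) :=
    tsum_subtype_eq_of_support_subset (s := {k : ℤ | k ≠ 0})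
      (f := fun n : ℤ => (F 0 n - F 0 0) / n * (nsinc (x - n) : ℂ)) fun n hn h0 => by
        subst h0
        simp at hn
  have hm := hF.mul_quotJet_zero x
  rw [← h] at hm
  rw [hsub]
  linear_combination -hm

end IsJet

/-! ### The logarithmic change of variable. -/

/-- Preimages under `exp` are images under `log`, and differentiable maps send null sets to null
sets. This transports almost-everywhere identities to the line. -/
theorem quasiMeasurePreserving_exp :
    Measure.QuasiMeasurePreserving Real.exp volume (volume.restrict (Ioi (0 : ℝ))) := by
  refine ⟨Real.measurable_exp, Measure.AbsolutelyContinuous.mk fun s hs h => ?_⟩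
  rw [Measure.restrict_apply hs] at h
  rw [Measure.map_apply Real.measurable_exp hs]
  have himg : Real.exp ⁻¹' s ⊆ Real.log '' (s ∩ Ioi 0) := fun x hx =>
    ⟨Real.exp x, ⟨hx, Real.exp_pos x⟩, Real.log_exp x⟩
  refine measure_mono_null himg (addHaar_image_eq_zero_of_differentiableOn_of_addHaar_eq_zero
    volume (fun x hx => ?_) h)
  exact (Real.differentiableAt_log (ne_of_gt hx.2)).differentiableWithinAt

theorem quasiMeasurePreserving_log :
    Measure.QuasiMeasurePreserving Real.log (volume.restrict (Ioi (0 : ℝ))) volume := by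
  refine ⟨Real.measurable_log, Measure.AbsolutelyContinuous.mk fun s hs h => ?_⟩
  rw [Measure.map_apply Real.measurable_log hs,
    Measure.restrict_apply (Real.measurable_log hs)]
  have himg : Real.log ⁻¹' s ∩ Ioi 0 ⊆ Real.exp '' s := fun x hx =>
    ⟨Real.log x, hx.1, Real.exp_log hx.2⟩
  exact measure_mono_null himg (addHaar_image_eq_zero_of_differentiableOn_of_addHaar_eq_zero
    volume Real.differentiable_exp.differentiableOn h)

/-- The `p`-th power of the weight is `e^(-u)`, which cancels the Jacobian `e^u`. -/
theorem xNorm_eq_eLpNorm_comp_exp {p : ℝ} (hp : 0 < p) (f : ℝ → ℂ) :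
    xNorm p f = eLpNorm (fun u => f (Real.exp u)) (ENNReal.ofReal p) volume := by
  have hp0 : ENNReal.ofReal p ≠ 0 := by simpa using hp
  rw [xNorm, eLpNorm_eq_lintegral_rpow_enorm_toReal hp0 ENNReal.ofReal_ne_top,
    eLpNorm_eq_lintegral_rpow_enorm_toReal hp0 ENNReal.ofReal_ne_top, ENNReal.toReal_ofReal hp.le]
  congr 1
  have hrange : Ioi (0 : ℝ) = Real.exp '' univ := by rw [image_univ, Real.range_exp]
  rw [hrange, lintegral_image_eq_lintegral_abs_deriv_mul (f' := Real.exp) MeasurableSet.univ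
    (fun x _ => (Real.hasDerivAt_exp x).hasDerivWithinAt) Real.exp_injective.injOn,
    Measure.restrict_univ]
  refine lintegral_congr fun u => ?_
  have h1 : ‖((Real.exp u ^ (-1 / p) : ℝ) : ℂ)‖ₑ ^ p = ENNReal.ofReal (Real.exp (-u)) := by
    rw [← ofReal_norm, Complex.norm_real,
      Real.norm_of_nonneg (Real.rpow_nonneg (Real.exp_pos u).le _),
      ENNReal.ofReal_rpow_of_nonneg (Real.rpow_nonneg (Real.exp_pos u).le _) hp.le,
      ← Real.rpow_mul (Real.exp_pos u).le, div_mul_cancel₀ _ hp.ne', Real.rpow_neg_one,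
      Real.exp_neg]
  rw [enorm_mul, ENNReal.mul_rpow_of_nonneg _ _ hp.le, h1, mul_left_comm,
    ← ENNReal.ofReal_mul (abs_nonneg _), abs_of_pos (Real.exp_pos u), ← Real.exp_add,
    add_neg_cancel, Real.exp_zero, ENNReal.ofReal_one, mul_one]

theorem MemX.memLp {p : ℝ} (hp : 0 < p) {f : ℝ → ℂ} (hf : MemX p f) :
    MemLp (fun u => f (Real.exp u)) (ENNReal.ofReal p) volume := by
  refine ⟨?_, ?_⟩
  · have h := (hf.1.comp_quasiMeasurePreserving quasiMeasurePreserving_exp).mul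
      ((Complex.continuous_ofReal.comp ((Real.continuous_exp).rpow_const (p := 1 / p)
        fun x => Or.inl (Real.exp_pos x).ne')).aestronglyMeasurable (μ := volume))
    refine h.congr (Eventually.of_forall fun u => ?_)
    simp only [Pi.mul_apply, Function.comp_apply]
    rw [mul_assoc, ← Complex.ofReal_mul, ← Real.rpow_add (Real.exp_pos u)]
    have : -1 / p + 1 / p = 0 := by ring
    rw [this, Real.rpow_zero, Complex.ofReal_one, mul_one]
  · rw [← xNorm_eq_eLpNorm_comp_exp hp]
    exact hf.2

/-! ### From `L^p` derivatives to smooth functions. -/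

/-- If `g` is the derivative of `h` in the sense of the `L^p` norm, then `h` is almost everywhere
equal to a primitive of `g`. -/
theorem exists_ae_eq_primitive {p : ENNReal} (hp : 1 ≤ p) {h g : ℝ → ℂ} (hh : MemLp h p volume)
    (hg : MemLp g p volume)
    (hd : Tendsto (fun t : ℝ => eLpNorm (fun u => (h (t + u) - h u) / (t : ℂ) - g u) p volume)
      (𝓝[≠] 0) (𝓝 0)) :
    ∃ (a : ℝ) (c : ℂ), h =ᵐ[volume] fun x => c + ∫ u in a..x, g u := by
  have hloc : LocallyIntegrable h volume := hh.locallyIntegrable hp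
  have hint : ∀ x y, IntervalIntegrable h volume x y := fun x y =>
    intervalIntegrable_iff.mpr ((hloc.integrableOn_isCompact isCompact_uIcc).mono_set
      uIoc_subset_uIcc)
  have hshift : ∀ t : ℝ, MemLp (fun u => h (t + u)) p volume := fun t =>
    hh.comp_measurePreserving (measurePreserving_add_left volume t)
  have hshiftint : ∀ t x y : ℝ, IntervalIntegrable (fun u => h (t + u)) volume x y := fun t x y =>
    intervalIntegrable_iff.mpr ((((hshift t).locallyIntegrable hp).integrableOn_isCompact
      isCompact_uIcc).mono_set uIoc_subset_uIcc)
  have hq : ∀ t : ℝ, MemLp (fun u => (h (t + u) - h u) / (t : ℂ)) p volume := fun t => by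
    simpa only [div_eq_mul_inv, Pi.sub_apply] using ((hshift t).sub hh).mul_const ((t : ℂ)⁻¹)
  -- Both endpoints `a` and `b` are taken to be points where the indefinite integral of `h` has
  -- derivative `h`.
  have hae := LocallyIntegrable.ae_hasDerivAt_integral hloc
  obtain ⟨a, ha⟩ := hae.exists
  refine ⟨a, h a, ?_⟩
  filter_upwards [hae] with b hb
  set μ : Measure ℝ := volume.restrict (uIoc a b) with hμ
  have hfin : IsFiniteMeasure μ := ⟨by
    rw [hμ, Measure.restrict_apply_univ, uIoc]; exact measure_Ioc_lt_top⟩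
  have hlim1 : Tendsto (fun t : ℝ => ∫ u, (h (t + u) - h u) / (t : ℂ) ∂μ) (𝓝[≠] 0)
      (𝓝 (∫ u, g u ∂μ)) := by
    refine tendsto_integral_of_L1' g hg.1.restrict
      (Eventually.of_forall fun t => ((hq t).restrict _).integrable hp) ?_
    have hc : μ univ ^ (1 / (1 : ENNReal).toReal - 1 / p.toReal) ≠ ⊤ := by
      refine ENNReal.rpow_ne_top_of_nonneg ?_ (measure_ne_top _ _)
      rcases eq_or_ne p ⊤ with rfl | hpt
      · simp
      · have : 1 ≤ p.toReal := by
          simpa using ENNReal.toReal_mono hpt hp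
        rw [ENNReal.toReal_one, div_one, sub_nonneg]
        exact (div_le_one (by linarith)).2 this
    have h0 := ENNReal.Tendsto.mul_const hd (Or.inr hc)
    rw [zero_mul] at h0
    refine tendsto_of_tendsto_of_tendsto_of_le_of_le tendsto_const_nhds h0
      (fun _ => zero_le) fun t => ?_
    refine (eLpNorm_le_eLpNorm_mul_rpow_measure_univ hp
      (((hq t).sub hg).1.restrict)).trans ?_
    gcongr
    exact eLpNorm_restrict_le _ _ _ _
  have hlim2 : Tendsto (fun t : ℝ => ∫ u in a..b, (h (t + u) - h u) / (t : ℂ)) (𝓝[≠] 0)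
      (𝓝 (∫ u in a..b, g u)) := by
    simp only [intervalIntegral.intervalIntegral_eq_integral_uIoc]
    exact hlim1.const_smul _
  -- The integral telescopes to the mean of `h` over `[b, b + t]` minus its mean over `[a, a + t]`.
  have hlim3 : Tendsto (fun t : ℝ => ∫ u in a..b, (h (t + u) - h u) / (t : ℂ)) (𝓝[≠] 0)
      (𝓝 (h b - h a)) := by
    refine ((hb a).tendsto_slope_zero.sub (ha a).tendsto_slope_zero).congr fun t => ?_
    rw [intervalIntegral.integral_div, intervalIntegral.integral_sub (hshiftint t a b) (hint a b),
      intervalIntegral.integral_comp_add_left, ← smul_sub, Complex.real_smul, div_eq_inv_mul,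
      Complex.ofReal_inv, intervalIntegral.integral_same, sub_zero, add_comm b, add_comm a,
      ← intervalIntegral.integral_interval_sub_left (hint a (t + b)) (hint a (t + a))]
    ring
  rw [tendsto_nhds_unique hlim2 hlim3]
  ring

/-- Average `h x = h y - ∫ g` over `y` in `(x, x + 1]`; on this probability space the `L^1` norm is
at most the `L^p` norm. -/
theorem enorm_le_eLpNorm_add_eLpNorm_deriv {p : ENNReal} (hp : 1 ≤ p) {h g : ℝ → ℂ}
    (hd : ∀ x, HasDerivAt h (g x) x) (hg : Continuous g) (x : ℝ) :
    ‖h x‖ₑ ≤ eLpNorm h p volume + eLpNorm g p volume := by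
  have hh : Continuous h := continuous_iff_continuousAt.2 fun x => (hd x).continuousAt
  set μ : Measure ℝ := volume.restrict (Ioc x (x + 1)) with hμ
  have hprob : IsProbabilityMeasure μ := ⟨by
    rw [hμ, Measure.restrict_apply_univ, Real.volume_Ioc]; simp⟩
  have hle : ∀ φ : ℝ → ℂ, Continuous φ → ∫⁻ y, ‖φ y‖ₑ ∂μ ≤ eLpNorm φ p volume := fun φ hφ => by
    rw [← eLpNorm_one_eq_lintegral_enorm]
    exact (eLpNorm_le_eLpNorm_of_exponent_le hp hφ.aestronglyMeasurable).trans
      (eLpNorm_restrict_le _ _ _ _)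
  have hpt : ∀ y ∈ Ioc x (x + 1), ‖h x‖ₑ ≤ ‖h y‖ₑ + ∫⁻ z, ‖g z‖ₑ ∂μ := fun y hy => by
    have h1 : h x = h y - ∫ z in Ioc x y, g z := by
      rw [← intervalIntegral.integral_of_le hy.1.le,
        intervalIntegral.integral_eq_sub_of_hasDerivAt (fun z _ => hd z)
          (hg.intervalIntegrable x y)]
      ring
    have h2 : ‖∫ z in Ioc x y, g z‖ₑ ≤ ∫⁻ z, ‖g z‖ₑ ∂μ :=
      (enorm_integral_le_lintegral_enorm _).trans
        (lintegral_mono_set (Ioc_subset_Ioc_right hy.2))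
    calc ‖h x‖ₑ = ‖h y - ∫ z in Ioc x y, g z‖ₑ := by rw [← h1]
      _ ≤ ‖h y‖ₑ + ‖∫ z in Ioc x y, g z‖ₑ := enorm_sub_le
      _ ≤ _ := by gcongr
  calc ‖h x‖ₑ = ∫⁻ _, ‖h x‖ₑ ∂μ := by simp
    _ ≤ ∫⁻ y, (‖h y‖ₑ + ∫⁻ z, ‖g z‖ₑ ∂μ) ∂μ := by
        refine lintegral_mono_ae ?_
        rw [hμ]
        filter_upwards [ae_restrict_mem measurableSet_Ioc] with y hy using hpt y hy
    _ = (∫⁻ y, ‖h y‖ₑ ∂μ) + ∫⁻ z, ‖g z‖ₑ ∂μ := by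
        rw [lintegral_add_right _ measurable_const]; simp
    _ ≤ _ := add_le_add (hle h hh) (hle g hg)

/-- In the variable `u = ln x`, a function of the Bernstein space is almost everywhere equal to
a smooth function whose `k`-th derivative is `O(σ ^ k)`, uniformly on the line. -/
theorem MemBernstein.exists_isJet {p σ : ℝ} (hp : 1 ≤ p) (hσ : 0 ≤ σ) {f : ℝ → ℂ}
    (hf : MemBernstein p σ f) :
    ∃ (C : ℝ) (H : ℕ → ℝ → ℂ), IsJet (fun _ => C) σ H ∧
      (fun u => f (Real.exp u)) =ᵐ[volume] H 0 := by
  obtain ⟨hfX, F, rfl, hF, hbound⟩ := hf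
  have hp0 : 0 < p := zero_lt_one.trans_le hp
  have hp1 : 1 ≤ ENNReal.ofReal p := by simpa using ENNReal.ofReal_le_ofReal hp
  have hL : ∀ k, MemLp (fun u => F k (Real.exp u)) (ENNReal.ofReal p) volume :=
    fun k => (hF k).1.memLp hp0
  have hex : ∀ k, ∃ (a : ℝ) (c : ℂ), (fun u => F k (Real.exp u)) =ᵐ[volume]
      fun x => c + ∫ u in a..x, F (k + 1) (Real.exp u) := fun k => by
    refine exists_ae_eq_primitive hp1 (hL k) (hL (k + 1)) ?_
    have h := (hF k).2.2
    simp only [xNorm_eq_eLpNorm_comp_exp hp0, mellinTranslation, ← Real.exp_add] at h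
    exact h
  choose a c hac using hex
  set H : ℕ → ℝ → ℂ := fun k x => c k + ∫ u in (a k)..x, F (k + 1) (Real.exp u) with hH
  have hcont : ∀ k, Continuous (H k) := fun k =>
    continuous_const.add (intervalIntegral.continuous_primitive (fun x y =>
      intervalIntegrable_iff.mpr ((((hL (k + 1)).locallyIntegrable hp1).integrableOn_isCompact
        isCompact_uIcc).mono_set uIoc_subset_uIcc)) _)
  have hderiv : ∀ k x, HasDerivAt (H k) (H (k + 1) x) x := fun k x => by
    -- Replacing the integrand by its continuous version makes the derivative exist at every point.
    have hEq : H k = fun x => c k + ∫ u in (a k)..x, H (k + 1) u := funext fun y => by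
      refine congrArg (c k + ·) (intervalIntegral.integral_congr_ae ?_)
      filter_upwards [hac (k + 1)] with u hu _ using hu
    rw [hEq]
    exact (intervalIntegral.integral_hasDerivAt_right ((hcont _).intervalIntegrable _ _)
      ((hcont _).stronglyMeasurableAtFilter _ _) (hcont _).continuousAt).const_add _
  set N : ENNReal := xNorm p (F 0) with hN
  have hNtop : N ≠ ⊤ := hfX.2.ne
  have hnorm : ∀ k, eLpNorm (H k) (ENNReal.ofReal p) volume ≤ ENNReal.ofReal (σ ^ k) * N :=
    fun k => by
      rw [← eLpNorm_congr_ae (hac k), ← xNorm_eq_eLpNorm_comp_exp hp0]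
      exact hbound k
  refine ⟨(1 + σ) * N.toReal, H, ⟨hderiv, fun k x => ?_⟩, hac 0⟩
  have h1 := (enorm_le_eLpNorm_add_eLpNorm_deriv hp1 (hderiv k) (hcont (k + 1)) x).trans
    (add_le_add (hnorm k) (hnorm (k + 1)))
  rw [← ENNReal.ofReal_toReal hNtop, ← ENNReal.ofReal_mul (by positivity),
    ← ENNReal.ofReal_mul (by positivity), ← ENNReal.ofReal_add (by positivity) (by positivity),
    ← ofReal_norm, ENNReal.ofReal_le_ofReal_iff (by positivity)] at h1
  refine h1.trans (le_of_eq ?_)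
  rw [pow_succ]
  ring

theorem isContinuousRep_comp_log {f : ℝ → ℂ} {h : ℝ → ℂ} (hh : Continuous h)
    (hfh : (fun u => f (Real.exp u)) =ᵐ[volume] h) :
    IsContinuousRep f (fun x => h (Real.log x)) := by
  refine ⟨hh.comp_continuousOn (Real.continuousOn_log.mono fun x hx => ne_of_gt hx), ?_⟩
  filter_upwards [quasiMeasurePreserving_log.ae_eq_comp hfh, ae_restrict_mem measurableSet_Ioi]
    with x hx hx0
  simpa only [Function.comp_apply, Real.exp_log hx0] using hx

theorem IsContinuousRep.eq_comp_log {f g h : ℝ → ℂ} (hg : IsContinuousRep f g)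
    (hh : Continuous h) (hfh : (fun u => f (Real.exp u)) =ᵐ[volume] h) (u : ℝ) :
    g (Real.exp u) = h u := by
  have hc : Continuous fun u => g (Real.exp u) :=
    hg.1.comp_continuous Real.continuous_exp fun u => Real.exp_pos u
  exact congrFun ((Continuous.ae_eq_iff_eq volume hc hh).1
    ((quasiMeasurePreserving_exp.ae_eq_comp hg.2).symm.trans hfh)) u

end MellinBernstein

/-! ### The sampling formula on the half-line. -/

theorem mainTheorem5 (p σ : ℝ) (hp : 1 < p) (hσ : 0 < σ) (f : ℝ → ℂ)
    (hf : MellinBernstein.MemBernstein p σ f) :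
    (∃ g : ℝ → ℂ, MellinBernstein.IsContinuousRep f g) ∧
    ∀ g : ℝ → ℂ, MellinBernstein.IsContinuousRep f g →
      DifferentiableAt ℝ g 1 ∧
      ∃ S : ℝ → ℂ,
        (∀ K : Set ℝ, K ⊆ Set.Ioi (0 : ℝ) → IsCompact K →
          TendstoUniformlyOn
            (fun (s : Finset {k : ℤ // k ≠ 0}) (τ : ℝ) =>
              ∑ k ∈ s, MellinBernstein.samplingTerm σ g (k : ℤ) τ)
            S Filter.atTop K) ∧
        ∀ τ : ℝ, 0 < τ →
          g τ = g 1
            + (Real.log τ : ℂ) * deriv g 1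
              * ((MellinBernstein.nsinc (σ / Real.pi * Real.log τ) : ℝ) : ℂ)
            + (Real.log τ : ℂ) * S τ := by
  obtain ⟨C, H, hH, hae⟩ := hf.exists_isJet hp.le hσ.le
  refine ⟨⟨_, MellinBernstein.isContinuousRep_comp_log (hH.continuous 0) hae⟩, fun g hg => ?_⟩
  have hgH := hg.eq_comp_log (hH.continuous 0) hae
  have hpi := Real.pi_pos
  have hg1 : g 1 = H 0 0 := by rw [← hgH, Real.exp_zero]
  have hderiv : HasDerivAt g (H 1 0) 1 := by
    have h1 := hH.hasDerivAt_comp 0 (Real.hasDerivAt_log one_ne_zero)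
    rw [Real.log_one, inv_one, Complex.ofReal_one, one_mul] at h1
    refine h1.congr_of_eventuallyEq ?_
    filter_upwards [Ioi_mem_nhds zero_lt_one] with x hx
    rw [← hgH, Real.exp_log hx]
  -- The dilation by `π / σ` normalizes the growth rate to `π` and sends the nodes `kπ/σ` to the
  -- integers.
  have hJ : MellinBernstein.IsJet (fun _ => C) Real.pi
      (fun k x => ((Real.pi / σ : ℝ) : ℂ) ^ k * H k (Real.pi / σ * x - 0)) := by
    have h := hH.comp_mul_sub (Real.pi / σ) 0 (div_pos hpi hσ).le
    rwa [div_mul_cancel₀ _ hσ.ne'] at h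
  have hσ' : (σ : ℂ) ≠ 0 := by exact_mod_cast hσ.ne'
  have hpi' : (Real.pi : ℂ) ≠ 0 := by exact_mod_cast hpi.ne'
  have hterm : ∀ (k : ℤ) (τ : ℝ), MellinBernstein.samplingTerm σ g k τ = ((σ / Real.pi : ℝ) : ℂ) *
      ((H 0 (Real.pi / σ * k) - H 0 0) / k * (MellinBernstein.nsinc (σ / Real.pi * Real.log τ - k) : ℂ)) := by
    intro k τ
    have hk : (k : ℝ) * Real.pi / σ = Real.pi / σ * k := by ring
    rw [MellinBernstein.samplingTerm, hgH, hg1, hk]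
    push_cast
    rcases eq_or_ne k 0 with rfl | hk0
    · simp
    have : (k : ℂ) ≠ 0 := by exact_mod_cast hk0
    field_simp
  refine ⟨hderiv.differentiableAt,
    fun τ => ∑' k : {k : ℤ // k ≠ 0}, MellinBernstein.samplingTerm σ g (k : ℤ) τ, fun K hK hKc => ?_,
    fun τ hτ => ?_⟩
  · have hlog : ContinuousOn (fun τ => σ / Real.pi * Real.log τ) K :=
      continuousOn_const.mul (Real.continuousOn_log.mono fun x hx => ne_of_gt (hK hx))
    obtain ⟨R, hR⟩ := hKc.exists_bound_of_continuousOn hlog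
    have hsum : Summable fun k : {k : ℤ // k ≠ 0} => (σ / Real.pi) *
        (2 * C * ((2 + Real.pi) * (1 + R)) * (1 / ((k : ℤ) : ℝ) ^ 2)) :=
      (((Real.summable_one_div_int_pow.2 one_lt_two).mul_left _).mul_left _).subtype _
    -- The Weierstrass test along the net of finite subsets gives unconditional and uniform
    -- convergence together.
    refine tendstoUniformlyOn_tsum hsum fun k τ hτ => ?_
    have h := hJ.norm_sampling_le (hR τ hτ) k
    simp only [pow_zero, one_mul, sub_zero, mul_zero] at h
    rw [hterm, norm_mul, Complex.norm_real, Real.norm_of_nonneg (div_pos hσ hpi).le]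
    exact mul_le_mul_of_nonneg_left h (div_pos hσ hpi).le
  · have h := hJ.sampling (σ / Real.pi * Real.log τ)
    have hx : Real.pi / σ * (σ / Real.pi * Real.log τ) = Real.log τ := by field_simp
    simp only [pow_zero, one_mul, sub_zero, mul_zero, pow_one, hx] at h
    simp only [hterm, tsum_mul_left]
    rw [hderiv.deriv, hg1, ← Real.exp_log hτ, hgH, Real.log_exp, h]
    push_cast
    field_simp
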